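/- Let the pseudo-factorials $(\alpha_n)_{n\ge 0}$ be the integers defined by $\alpha_0=1$ and $$\alpha_{n+1}=(-1)^{n+1}\sum_{k=0}^{n}\binom{n}{k}\alpha_k\,\alpha_{n-k}\qquad(n\ge 0),$$ and let $F(z)=\sum_{n\ge 0}\alpha_n z^n$ be their ordinary generating function. Then, as formal power series, $$F(z)=\cfrac{1}{1-c_0z-\cfrac{a_1z^2}{1-c_1z-\cfrac{a_2z^2}{1-c_2z-\cfrac{a_3z^2}{\ddots}}}},\qquad c_j=(-1)^{j-1}\left(j+\frac{1+(-1)^j}{2}\right)\ (j\ge 0),\quad a_j=-j^2\left(2-(-1)^j\right)\ (j\ge 1),$$ meaning that for each $m$ the coefficient of $z^m$ in the $n$-th convergent (the finite fraction that ends with the denominator $1-c_{n-1}z$) equals $\alpha_m$ for all sufficiently large $n$. Here, for all $i\ge 0$, $c_{2i}=-(2i+1)$, $c_{2i+1}=2i+1$, $a_{2i+1}=-3(2i+1)^2$ and $a_{2i+2}=-(2i+2)^2$; that is, $$F(z)=\cfrac{1}{1+z+\cfrac{3\cdot 1^2\cdot z^2}{1-z+\cfrac{2^2\cdot z^2}{1+3z+\cfrac{3\cdot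 3^2\cdot z^2}{1-3z+\cfrac{4^2\cdot z^2}{\ddots}}}}}.$$ -/

import Mathlib

/-- The pseudo-factorials: `α 0 = 1` and
`α (n+1) = (-1)^(n+1) * ∑_{k=0}^{n} binom(n,k) α k α (n-k)`. -/
def pseudoFactorial : ℕ → ℤ
  | 0 => 1
  | n + 1 => (-1) ^ (n + 1) *
      ∑ k : Fin (n + 1), (n.choose k : ℤ) * pseudoFactorial k * pseudoFactorial (n - k)

theorem pseudoFactorial_zero : pseudoFactorial 0 = 1 := by
  rw [pseudoFactorial]

/-- The defining recurrence, with the sum over natural numbers `0 ≤ k ≤ n`. -/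
theorem pseudoFactorial_succ (n : ℕ) :
    pseudoFactorial (n + 1) = (-1) ^ (n + 1) *
      ∑ k ∈ Finset.range (n + 1),
        (n.choose k : ℤ) * pseudoFactorial k * pseudoFactorial (n - k) := by
  rw [pseudoFactorial, Finset.sum_range]

/-- The ordinary generating function `F(z) = ∑ α_n z^n`, a formal power series over `ℚ`. -/
def pseudoFactorialOGF : PowerSeries ℚ :=
  PowerSeries.mk fun n => (pseudoFactorial n : ℚ)

section JFraction

variable {K : Type*} [Field K]

/-- The finite Jacobi fraction with `n` levels, whose top level has index `j`:
`1/(1 - c_j z - a_{j+1} z² /(1 - c_{j+1} z - ⋯ a_{j+n-1} z² / (1 - c_{j+n-1} z)))`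
(it is `0` for `n = 0`). Every denominator has constant coefficient `1`, so that each `⁻¹` is the
true inverse of a formal power series. -/
noncomputable def jFractionTrunc (c a : ℕ → K) : ℕ → ℕ → PowerSeries K
  | 0, _ => 0
  | n + 1, j => (1 - PowerSeries.C (c j) * PowerSeries.X
      - PowerSeries.C (a (j + 1)) * PowerSeries.X ^ 2 * jFractionTrunc c a n (j + 1))⁻¹

theorem constantCoeff_jFraction_denominator (c a : ℕ → K) (n j : ℕ) :
    PowerSeries.constantCoeff (1 - PowerSeries.C (c j) * PowerSeries.X
      - PowerSeries.C (a (j + 1)) * PowerSeries.X ^ 2 * jFractionTrunc c a n (j + 1)) = 1 := by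
  simp

/-- The `n`-th convergent of the Jacobi fraction
`1/(1 - c₀ z - a₁ z²/(1 - c₁ z - a₂ z²/⋱))`. -/
noncomputable def jFractionConvergent (c a : ℕ → K) (n : ℕ) : PowerSeries K :=
  jFractionTrunc c a n 0

/-- `Φ = 1/(1 - c₀ z - a₁ z²/(1 - c₁ z - a₂ z²/⋱))` as formal power series: the convergents tend
to `Φ` in the ring of formal power series, that is, each coefficient of the convergents is
eventually constant, equal to the corresponding coefficient of `Φ`. (The value `a 0` is unused.) -/
def HasJFraction (Φ : PowerSeries K) (c a : ℕ → K) : Prop :=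
  ∀ m : ℕ, ∃ N : ℕ, ∀ n ≥ N,
    PowerSeries.coeff m (jFractionConvergent c a n) = PowerSeries.coeff m Φ

end JFraction

/-- `c_j = (-1)^(j-1) (j + (1 + (-1)^j)/2)`; the exponent `j - 1` is an integer (`-1` at `j = 0`). -/
def pseudoC (j : ℕ) : ℚ :=
  (-1 : ℚ) ^ ((j : ℤ) - 1) * ((j : ℚ) + (1 + (-1 : ℚ) ^ j) / 2)

/-- `a_j = -j² (2 - (-1)^j)`. -/
def pseudoA (j : ℕ) : ℚ :=
  -((j : ℚ) ^ 2) * (2 - (-1 : ℚ) ^ j)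

/-! Let `f` be the EGF and `g(z) = f(-z)`. The recurrence says `f' = -g²`, `g' = f²`, hence `f³ + g³
= 2`. Modulo this cubic, differentiation is tridiagonal on the family `f u^k`, `(g² - f) u^k` with
`u = 1 - f g` (`pseudoBasis`). The formal Laplace transform sends `f` to the OGF and turns
differentiation into division by `z` after removal of the constant term, so the transforms satisfy a
three-term recurrence. Ratios of consecutive transforms then unfold into the J-fraction, with
`a_{j+1}` the product of the two off-diagonal entries linking `j` and `j + 1`. -/

open PowerSeries in
/-- A solution `Ψ` of the three-term recurrence attached to a Jacobi fraction with `X ^ j ∣ Ψ (j+1)`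
has ratios approximated by the truncated fractions. -/
theorem X_pow_dvd_sub_jFractionTrunc_mul {K : Type*} [Field K] (c a d : ℕ → K)
    (B Ψ : ℕ → PowerSeries K)
    (hrec : ∀ j, Ψ (j + 1) = B j * Ψ j + C (c j) * X * Ψ (j + 1) + C (d j) * X * Ψ (j + 2))
    (hB : ∀ j, C (d j) * B (j + 1) = C (a (j + 1)) * X)
    (hΨ : ∀ j, X ^ j ∣ Ψ (j + 1)) (n j : ℕ) :
    X ^ (j + 2 * n) ∣ Ψ (j + 1) - B j * jFractionTrunc c a n j * Ψ j := by
  induction n generalizing j with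
  | zero => simpa [jFractionTrunc] using hΨ j
  | succ n ih =>
    obtain ⟨q, hq⟩ := ih (j + 1)
    have hinv := PowerSeries.mul_inv_cancel (1 - C (c j) * X
      - C (a (j + 1)) * X ^ 2 * jFractionTrunc c a n (j + 1)) (by simp)
    rw [jFractionTrunc]
    set D := 1 - C (c j) * X - C (a (j + 1)) * X ^ 2 * jFractionTrunc c a n (j + 1) with hD
    refine ⟨D⁻¹ * C (d j) * q, ?_⟩
    -- The recurrence multiplies the level `j + 1` error, of order `j + 1 + 2n`, by one more `X`.
    have key : D * Ψ (j + 1) = B j * Ψ j + C (d j) * X ^ (j + 2 * (n + 1)) * q := by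
      have hpow : (X : PowerSeries K) ^ (j + 2 * (n + 1)) = X * X ^ (j + 1 + 2 * n) := by ring
      rw [hpow, hD]
      linear_combination hrec j + C (d j) * X * hq
        + X * jFractionTrunc c a n (j + 1) * Ψ (j + 1) * hB j
    linear_combination D⁻¹ * key - Ψ (j + 1) * hinv

open PowerSeries in
theorem hasJFraction_of_recurrence {K : Type*} [Field K] (c a b d : ℕ → K)
    (Φ : ℕ → PowerSeries K)
    (h0 : Φ 0 = 1 + C (c 0) * X * Φ 0 + C (d 0) * X * Φ 1)
    (hrec : ∀ j, Φ (j + 1) = C (b (j + 1)) * X * Φ j + C (c (j + 1)) * X * Φ (j + 1)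
      + C (d (j + 1)) * X * Φ (j + 2))
    (hbd : ∀ j, d j * b (j + 1) = a (j + 1)) : HasJFraction (Φ 0) c a := by
  -- Each factor `X` lowers the degree by one, while the index drops by at most one.
  have hvanish : ∀ m j, m < j → coeff m (Φ j) = 0 := by
    intro m
    induction m with
    | zero =>
      rintro (_ | j) hj
      · omega
      · rw [hrec j]; simp
    | succ m ih =>
      rintro (_ | j) hj
      · omega
      · rw [hrec j]
        simp only [map_add, mul_assoc, coeff_C_mul, coeff_succ_X_mul]
        rw [ih j (by omega), ih (j + 1) (by omega), ih (j + 2) (by omega)]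
        simp
  -- Prepending `1` makes `h0` an instance of the homogeneous recurrence; its term `1` carries no
  -- `X`, so `B 0 = 1`.
  let Ψ : ℕ → PowerSeries K := fun j => Nat.casesOn j 1 Φ
  let B : ℕ → PowerSeries K := fun j => Nat.casesOn j 1 fun i => C (b (i + 1)) * X
  have main := X_pow_dvd_sub_jFractionTrunc_mul c a d B Ψ
    (by
      rintro (_ | j)
      · change Φ 0 = 1 * 1 + C (c 0) * X * Φ 0 + C (d 0) * X * Φ 1
        rwa [mul_one]
      · exact hrec j)
    (by
      intro j
      simp only [B, ← hbd j, map_mul]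
      ring)
    (fun j => X_pow_dvd_iff.2 fun m hm => hvanish m j hm)
  intro m
  refine ⟨m + 1, fun n hn => ?_⟩
  have h : coeff m (Φ 0 - 1 * jFractionTrunc c a n 0 * 1) = 0 :=
    X_pow_dvd_iff.1 (main n 0) m (by omega)
  rw [one_mul, mul_one, map_sub, sub_eq_zero] at h
  exact h.symm

/-! ### The differential system and the Fermat cubic -/

/-- The exponential generating function of the pseudo-factorials. -/
noncomputable def pseudoFactorialEGF : PowerSeries ℚ :=
  PowerSeries.mk fun n => (pseudoFactorial n : ℚ) / n.factorial

/-- The exponential generating function of the pseudo-factorials, at `-z`. -/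
noncomputable def pseudoFactorialEGFNeg : PowerSeries ℚ :=
  PowerSeries.mk fun n => (-1) ^ n * (pseudoFactorial n : ℚ) / n.factorial

theorem pseudoFactorial_succ_div_factorial (n : ℕ) :
    (pseudoFactorial (n + 1) : ℚ) / n.factorial = (-1) ^ (n + 1) *
      ∑ p ∈ Finset.HasAntidiagonal.antidiagonal n, (pseudoFactorial p.1 : ℚ) / p.1.factorial *
        ((pseudoFactorial p.2 : ℚ) / p.2.factorial) := by
  rw [pseudoFactorial_succ, Finset.Nat.sum_antidiagonal_eq_sum_range_succ_mk]
  push_cast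
  rw [mul_div_assoc, Finset.sum_div]
  congr 1
  refine Finset.sum_congr rfl fun k hk => ?_
  rw [Nat.cast_choose ℚ (Finset.mem_range_succ_iff.1 hk)]
  have := n.factorial_ne_zero
  field_simp

open PowerSeries in
theorem derivative_pseudoFactorialEGF :
    d⁄dX ℚ pseudoFactorialEGF = -pseudoFactorialEGFNeg ^ 2 := by
  ext n
  have hsucc := pseudoFactorial_succ_div_factorial n
  have h1 : (pseudoFactorial (n + 1) : ℚ) / (n + 1).factorial * (n + 1)
      = (pseudoFactorial (n + 1) : ℚ) / n.factorial := by
    rw [Nat.factorial_succ]; push_cast; field_simp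
  rw [coeff_derivative, pseudoFactorialEGF, coeff_mk, h1, hsucc, map_neg, sq, coeff_mul, pow_succ,
    mul_neg_one, neg_mul, Finset.mul_sum]
  congr 1
  refine Finset.sum_congr rfl fun p hp => ?_
  rw [← Finset.HasAntidiagonal.mem_antidiagonal.1 hp, pseudoFactorialEGFNeg, coeff_mk, coeff_mk]
  ring

open PowerSeries in
theorem derivative_pseudoFactorialEGFNeg :
    d⁄dX ℚ pseudoFactorialEGFNeg = pseudoFactorialEGF ^ 2 := by
  ext n
  have hsucc := pseudoFactorial_succ_div_factorial n
  have h1 : (-1) ^ (n + 1) * (pseudoFactorial (n + 1) : ℚ) / (n + 1).factorial * (n + 1)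
      = (-1) ^ (n + 1) * ((pseudoFactorial (n + 1) : ℚ) / n.factorial) := by
    rw [Nat.factorial_succ]; push_cast; field_simp
  rw [coeff_derivative, pseudoFactorialEGFNeg, coeff_mk, h1, hsucc, sq, coeff_mul, ← mul_assoc,
    ← mul_pow]
  simp [pseudoFactorialEGF]

theorem constantCoeff_pseudoFactorialEGF :
    PowerSeries.constantCoeff pseudoFactorialEGF = 1 := by
  rw [← PowerSeries.coeff_zero_eq_constantCoeff_apply, pseudoFactorialEGF, PowerSeries.coeff_mk]
  simp [pseudoFactorial_zero]

theorem constantCoeff_pseudoFactorialEGFNeg :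
    PowerSeries.constantCoeff pseudoFactorialEGFNeg = 1 := by
  rw [← PowerSeries.coeff_zero_eq_constantCoeff_apply, pseudoFactorialEGFNeg,
    PowerSeries.coeff_mk]
  simp [pseudoFactorial_zero]

/-- The EGF parametrizes the Fermat cubic `f³ + g³ = 2`. -/
theorem pseudoFactorialEGF_cube_add_cube :
    pseudoFactorialEGF ^ 3 + pseudoFactorialEGFNeg ^ 3 = 2 := by
  have h2 : (2 : PowerSeries ℚ) = PowerSeries.C 2 := (map_ofNat _ 2).symm
  refine PowerSeries.derivative.ext ?_ ?_
  · rw [h2, PowerSeries.derivative_C, map_add, Derivation.leibniz_pow, Derivation.leibniz_pow,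
      derivative_pseudoFactorialEGF, derivative_pseudoFactorialEGFNeg]
    simp only [smul_eq_mul, nsmul_eq_mul]
    ring
  · rw [h2]
    simp only [map_add, map_pow, constantCoeff_pseudoFactorialEGF,
      constantCoeff_pseudoFactorialEGFNeg, PowerSeries.constantCoeff_C]
    norm_num

/-! ### The formal Laplace transform -/

/-- The formal Laplace transform `∑ x_n z^n ↦ ∑ n! x_n z^n`. -/
noncomputable def PowerSeries.laplace (φ : PowerSeries ℚ) : PowerSeries ℚ :=
  PowerSeries.mk fun n => (n.factorial : ℚ) * PowerSeries.coeff n φ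

-- Formal integration by parts, from `(n+1)! = (n+1) n!`.
open PowerSeries in
theorem PowerSeries.laplace_eq (φ : PowerSeries ℚ) :
    φ.laplace = C (constantCoeff φ) + X * (d⁄dX ℚ φ).laplace := by
  ext n
  cases n with
  | zero => simp [laplace]
  | succ n =>
    rw [map_add, coeff_succ_X_mul, coeff_C, if_neg n.succ_ne_zero, zero_add, laplace, laplace,
      coeff_mk, coeff_mk, coeff_derivative, Nat.factorial_succ]
    push_cast
    ring

theorem PowerSeries.laplace_add (φ ψ : PowerSeries ℚ) :
    (φ + ψ).laplace = φ.laplace + ψ.laplace := by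
  ext n; simp [laplace, mul_add]

theorem PowerSeries.laplace_C_mul (r : ℚ) (φ : PowerSeries ℚ) :
    (PowerSeries.C r * φ).laplace = PowerSeries.C r * φ.laplace := by
  ext n; simp only [laplace, coeff_mk, coeff_C_mul]; ring

theorem pseudoFactorialOGF_eq_laplace :
    pseudoFactorialOGF = pseudoFactorialEGF.laplace := by
  ext n
  have := n.factorial_ne_zero
  simp only [pseudoFactorialOGF, pseudoFactorialEGF, PowerSeries.laplace, PowerSeries.coeff_mk]
  field_simp

/-! ### The tridiagonal derivative -/

/-- The sequence `f, h, f u, h u, f u², h u², …` with `h = g² - f` and `u = 1 - f g`, closed under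
the derivative up to a tridiagonal matrix. -/
noncomputable def pseudoBasis (j : ℕ) : PowerSeries ℚ :=
  (if Even j then pseudoFactorialEGF else pseudoFactorialEGFNeg ^ 2 - pseudoFactorialEGF) *
    (1 - pseudoFactorialEGF * pseudoFactorialEGFNeg) ^ (j / 2)

theorem pseudoBasis_even (k : ℕ) : pseudoBasis (2 * k) =
    pseudoFactorialEGF * (1 - pseudoFactorialEGF * pseudoFactorialEGFNeg) ^ k := by
  simp [pseudoBasis]

theorem pseudoBasis_odd (k : ℕ) : pseudoBasis (2 * k + 1) =
    (pseudoFactorialEGFNeg ^ 2 - pseudoFactorialEGF) *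
      (1 - pseudoFactorialEGF * pseudoFactorialEGFNeg) ^ k := by
  rw [pseudoBasis, if_neg (by simp), show (2 * k + 1) / 2 = k by omega]

theorem constantCoeff_pseudoBasis_zero :
    PowerSeries.constantCoeff (pseudoBasis 0) = 1 := by
  simp [pseudoBasis, constantCoeff_pseudoFactorialEGF]

theorem constantCoeff_pseudoBasis_succ (j : ℕ) :
    PowerSeries.constantCoeff (pseudoBasis (j + 1)) = 0 := by
  obtain ⟨k, hk | hk⟩ := Nat.even_or_odd' (j + 1) <;> rw [hk]
  · obtain ⟨l, rfl⟩ : ∃ l, k = l + 1 := ⟨k - 1, by omega⟩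
    simp [pseudoBasis_even, constantCoeff_pseudoFactorialEGF, constantCoeff_pseudoFactorialEGFNeg]
  · simp [pseudoBasis_odd, constantCoeff_pseudoFactorialEGF, constantCoeff_pseudoFactorialEGFNeg]

open PowerSeries in
theorem derivative_one_sub_pseudoFactorialEGF_mul_pow (k : ℕ) :
    d⁄dX ℚ ((1 - pseudoFactorialEGF * pseudoFactorialEGFNeg) ^ (k + 1)) =
      ((k : PowerSeries ℚ) + 1) * (1 - pseudoFactorialEGF * pseudoFactorialEGFNeg) ^ k *
        (pseudoFactorialEGFNeg ^ 3 - pseudoFactorialEGF ^ 3) := by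
  rw [Derivation.leibniz_pow, map_sub, Derivation.leibniz, Derivation.map_one_eq_zero,
    derivative_pseudoFactorialEGF, derivative_pseudoFactorialEGFNeg]
  simp only [smul_eq_mul, nsmul_eq_mul, Nat.add_sub_cancel]
  push_cast
  ring

open PowerSeries in
theorem derivative_pseudoBasis_zero :
    d⁄dX ℚ (pseudoBasis 0) = -pseudoBasis 0 - pseudoBasis 1 := by
  rw [show pseudoBasis 0 = _ from pseudoBasis_even 0, show pseudoBasis 1 = _ from pseudoBasis_odd 0]
  simp only [pow_zero, mul_one, derivative_pseudoFactorialEGF]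
  ring

open PowerSeries in
theorem derivative_pseudoBasis_odd (k : ℕ) :
    d⁄dX ℚ (pseudoBasis (2 * k + 1)) = 3 * (2 * (k : PowerSeries ℚ) + 1) * pseudoBasis (2 * k)
      + (2 * (k : PowerSeries ℚ) + 1) * pseudoBasis (2 * k + 1)
      - (2 * (k : PowerSeries ℚ) + 2) * pseudoBasis (2 * k + 2) := by
  rw [show 2 * k + 2 = 2 * (k + 1) by ring, pseudoBasis_odd, pseudoBasis_even, pseudoBasis_even,
    Derivation.leibniz, map_sub, Derivation.leibniz_pow (a := pseudoFactorialEGFNeg), derivative_pseudoFactorialEGF,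
    derivative_pseudoFactorialEGFNeg]
  have hcube := pseudoFactorialEGF_cube_add_cube
  cases k with
  | zero =>
    simp only [pow_zero, Derivation.map_one_eq_zero, smul_eq_mul, nsmul_eq_mul]
    push_cast
    ring
  | succ k =>
    rw [derivative_one_sub_pseudoFactorialEGF_mul_pow]
    simp only [smul_eq_mul, nsmul_eq_mul]
    push_cast
    generalize pseudoFactorialEGF = f at *
    generalize pseudoFactorialEGFNeg = g at *
    -- Modulo the cubic, `(g² - f) u' = 2 u (g² + f + f² g)`, which restores the lost factor `u`.
    linear_combination ((k : PowerSeries ℚ) + 1) * (1 - f * g) ^ k * (g ^ 2 + f) * hcube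

open PowerSeries in
theorem derivative_pseudoBasis_even (k : ℕ) :
    d⁄dX ℚ (pseudoBasis (2 * k + 2)) = (2 * (k : PowerSeries ℚ) + 2) * pseudoBasis (2 * k + 1)
      - (2 * (k : PowerSeries ℚ) + 3) * pseudoBasis (2 * k + 2)
      - (2 * (k : PowerSeries ℚ) + 3) * pseudoBasis (2 * k + 3) := by
  rw [show 2 * k + 3 = 2 * (k + 1) + 1 by ring, show 2 * k + 2 = 2 * (k + 1) by ring,
    pseudoBasis_odd, pseudoBasis_odd, pseudoBasis_even, Derivation.leibniz,
    derivative_pseudoFactorialEGF, derivative_one_sub_pseudoFactorialEGF_mul_pow]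
  have hcube := pseudoFactorialEGF_cube_add_cube
  simp only [smul_eq_mul]
  generalize pseudoFactorialEGF = f at *
  generalize pseudoFactorialEGFNeg = g at *
  -- Modulo the cubic, `f u' = 2 f (g³ - 1) = 2 (g² - f) - 2 g² u`.
  linear_combination -((k : PowerSeries ℚ) + 1) * (1 - f * g) ^ k * f * hcube

theorem pseudoC_even (i : ℕ) : pseudoC (2 * i) = -(2 * (i : ℚ) + 1) := by
  rw [pseudoC, zpow_sub₀ (by norm_num), zpow_natCast]
  norm_num [pow_mul]

theorem pseudoC_odd (i : ℕ) : pseudoC (2 * i + 1) = 2 * (i : ℚ) + 1 := by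
  rw [pseudoC, zpow_sub₀ (by norm_num), zpow_natCast]
  norm_num [pow_mul, pow_succ]

theorem pseudoA_odd (i : ℕ) : pseudoA (2 * i + 1) = -(3 * (2 * (i : ℚ) + 1) ^ 2) := by
  simp only [pseudoA, pow_succ (-1 : ℚ), pow_mul]
  push_cast
  norm_num
  ring

theorem pseudoA_even (i : ℕ) : pseudoA (2 * i + 2) = -(2 * (i : ℚ) + 2) ^ 2 := by
  simp only [pseudoA, pow_add (-1 : ℚ), pow_mul]
  push_cast
  norm_num

open PowerSeries in
theorem derivative_pseudoBasis_succ (j : ℕ) :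
    d⁄dX ℚ (pseudoBasis (j + 1)) =
      C (((j + 1 : ℕ) : ℚ) * (2 - (-1) ^ (j + 1))) * pseudoBasis j
      + C (pseudoC (j + 1)) * pseudoBasis (j + 1)
      + C (-(((j + 1 : ℕ) : ℚ) + 1)) * pseudoBasis (j + 2) := by
  obtain ⟨k, rfl | rfl⟩ := Nat.even_or_odd' j
  · rw [derivative_pseudoBasis_odd, pseudoC_odd, pow_succ, pow_mul]
    norm_num [map_ofNat]
    ring
  · rw [show 2 * k + 1 + 1 = 2 * (k + 1) by ring, pseudoC_even, pow_mul,
      show 2 * (k + 1) = 2 * k + 2 by ring, derivative_pseudoBasis_even]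
    norm_num [map_ofNat]
    ring

theorem hasJFraction_pseudoFactorialOGF : HasJFraction pseudoFactorialOGF pseudoC pseudoA := by
  have h0 : pseudoFactorialOGF = (pseudoBasis 0).laplace := by
    rw [pseudoFactorialOGF_eq_laplace]; simp [pseudoBasis]
  rw [h0]
  refine hasJFraction_of_recurrence pseudoC pseudoA (fun j => (j : ℚ) * (2 - (-1) ^ j))
    (fun j => -((j : ℚ) + 1)) (fun j => (pseudoBasis j).laplace) ?_ ?_ ?_
  · have hd : PowerSeries.derivative ℚ (pseudoBasis 0) =
        PowerSeries.C (pseudoC 0) * pseudoBasis 0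
          + PowerSeries.C (-(((0 : ℕ) : ℚ) + 1)) * pseudoBasis 1 := by
      rw [derivative_pseudoBasis_zero, show pseudoC 0 = _ from pseudoC_even 0]
      simp
      ring
    nth_rw 1 [PowerSeries.laplace_eq]
    rw [constantCoeff_pseudoBasis_zero, hd]
    simp only [PowerSeries.laplace_add, PowerSeries.laplace_C_mul, map_one]
    ring
  · intro j
    nth_rw 1 [PowerSeries.laplace_eq]
    rw [constantCoeff_pseudoBasis_succ, derivative_pseudoBasis_succ]
    simp only [PowerSeries.laplace_add, PowerSeries.laplace_C_mul, map_zero]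
    ring
  · intro j
    simp only [pseudoA]
    push_cast
    ring

/-- The ordinary generating function of the pseudo-factorials has the J-fraction expansion with
coefficients `c_j`, `a_j`; the last four clauses spell out the displayed fraction: its denominators
`1 - c_j z` are `1 + z, 1 - z, 1 + 3z, 1 - 3z, …` and its numerators `-a_j z²` have the coefficients
`3·1², 2², 3·3², 4², …`. -/
theorem theorem7 :
    HasJFraction pseudoFactorialOGF pseudoC pseudoA ∧
    (∀ i : ℕ, -pseudoC (2 * i) = 2 * (i : ℚ) + 1) ∧
    (∀ i : ℕ, -pseudoC (2 * i + 1) = -(2 * (i : ℚ) + 1)) ∧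
    (∀ i : ℕ, -pseudoA (2 * i + 1) = 3 * (2 * (i : ℚ) + 1) ^ 2) ∧
    (∀ i : ℕ, -pseudoA (2 * i + 2) = (2 * (i : ℚ) + 2) ^ 2) := by
  refine ⟨hasJFraction_pseudoFactorialOGF, fun i => ?_, fun i => ?_, fun i => ?_, fun i => ?_⟩
  · rw [pseudoC_even, neg_neg]
  · rw [pseudoC_odd]
  · rw [pseudoA_odd, neg_neg]
  · rw [pseudoA_even, neg_neg]
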